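/- Matrices are complex, $\circ$ is the entrywise product, and for a matrix $M$ with no zero entry $M^{(-)}$ is its entrywise inverse; $M^{(-)T}$ is the transpose of $M^{(-)}$. Definitions. For $m\times m$ matrices $A,B$ let $X_A(M)=AM$ and $\Delta_B(M)=B\circ M$ be the corresponding operators on $m\times m$ matrices. The pair $(A,B)$ is an *invertible Jones pair* if $$X_A\Delta_BX_A=\Delta_BX_A\Delta_B\quad\text{and}\quad X_A\Delta_{B^T}X_A=\Delta_{B^T}X_A\Delta_{B^T},$$ and each of $A$, $B$ is invertible and has no zero entry. An $m\times m$ matrix $W$ with no zero entry is *type II* if $W\,W^{(-)T}=mI$; it is a *spin model with loop variable $\delta$* if $\delta^2=m$, $W$ is type II and, for all $a,b,c$, $$\sum_{x}\frac{W_{a,x}W_{x,b}}{W_{x,c}}=\delta\,\frac{W_{a,b}}{W_{b,c}W_{a,c}} .$$ For a matrix $W$ with no zero entry, the *Nomura algebra* $\mathcal N_W$ is the set of matrices $M$ for which all the vectors $We_i\circ W^{(-)}e_j$ are eigenvectors, and $\Theta_W$ is the map on $\mathcal N_W$ for which $\Theta_W(M)_{i,j}$ is the eigenvalue of $M$ on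 $We_i\circ W^{(-)}e_j$. Theorem. Let $(A,B)$ be an invertible Jones pair of $n\times n$ matrices with $A$ symmetric, and let $d\in\mathbb C$ with $d^2=n$. Put $$V=\begin{pmatrix} dA&-dA&B^{(-)}&B^{(-)}\\-dA&dA&B^{(-)}&B^{(-)}\\B^{(-)T}&B^{(-)T}&dA&-dA\\B^{(-)T}&B^{(-)T}&-dA&dA\end{pmatrix},\quad V'=\begin{pmatrix} dA&-dA&-B^{(-)}&-B^{(-)}\\-dA&dA&-B^{(-)}&-B^{(-)}\\-B^{(-)T}&-B^{(-)T}&dA&-dA\\-B^{(-)T}&-B^{(-)T}&-dA&dA\end{pmatrix}.$$ Then $V'=DVD$ with $D=\operatorname{diag}(I_{2n},-I_{2n})$, and $V'$ is a symmetric spin model with loop variable $-2d$. Moreover $\Theta_{V'}=\Theta_V$, that is, $\mathcal N_{V'}=\mathcal N_V$ and $\Theta_{V'}(M)=\Theta_V(M)$ for every $M$ in this algebra. -/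

import Mathlib

open scoped Matrix

namespace JonesPair

variable {ι : Type*} [Fintype ι] [DecidableEq ι]

/-- The operator `X_A : M ↦ A M` on the space of matrices. -/
def opX (A : Matrix ι ι ℂ) : Module.End ℂ (Matrix ι ι ℂ) where
  toFun M := A * M
  map_add' M N := Matrix.mul_add A M N
  map_smul' c M := Matrix.mul_smul A c M

/-- The operator `Δ_B : M ↦ B ∘ M` (entrywise product) on the space of matrices. -/
def opDelta (B : Matrix ι ι ℂ) : Module.End ℂ (Matrix ι ι ℂ) where
  toFun M := B ⊙ M
  map_add' M N := Matrix.hadamard_add B M N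
  map_smul' c M := Matrix.hadamard_smul B M c

/-- The braid relation `X_A Δ_B X_A = Δ_B X_A Δ_B`. -/
def BraidRelation (A B : Matrix ι ι ℂ) : Prop :=
  opX A * opDelta B * opX A = opDelta B * opX A * opDelta B

/-- All entries are nonzero, i.e. the matrix is invertible for the entrywise product. -/
def IsSchurInvertible {κ : Type*} (M : Matrix κ κ ℂ) : Prop :=
  ∀ i j, M i j ≠ 0

/-- The entrywise inverse `M^(-)`. -/
noncomputable def schurInv {κ : Type*} (M : Matrix κ κ ℂ) : Matrix κ κ ℂ :=
  M.map fun x => x⁻¹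

/-- `(A, B)` is an invertible Jones pair: `(A, B)` and `(A, Bᵀ)` both satisfy the braid relation,
and both matrices are invertible for the ordinary and for the entrywise product. -/
structure IsInvertibleJonesPair (A B : Matrix ι ι ℂ) : Prop where
  braid : BraidRelation A B
  braid_transpose : BraidRelation A Bᵀ
  isUnit_left : IsUnit A
  schur_left : IsSchurInvertible A
  isUnit_right : IsUnit B
  schur_right : IsSchurInvertible B

/-- Type-II matrices: `W (W^(-))ᵀ = |ι| I`, with all entries of `W` nonzero. -/
structure IsTypeII (W : Matrix ι ι ℂ) : Prop where
  schur : IsSchurInvertible W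
  mul_eq : W * (schurInv W)ᵀ = (Fintype.card ι : ℂ) • (1 : Matrix ι ι ℂ)

/-- `W` is a spin model with loop variable `δ`: `δ ^ 2` is the size of `W`, `W` is type II, and
the star-triangle relation holds. -/
structure IsSpinModel (W : Matrix ι ι ℂ) (δ : ℂ) : Prop where
  sq_loop : δ ^ 2 = (Fintype.card ι : ℂ)
  typeII : IsTypeII W
  star_triangle : ∀ a b c,
    ∑ x, W a x * W x b / W x c = δ * (W a b / (W b c * W a c))

/-- The vector `W e_i ∘ W^(-) e_j`. -/
noncomputable def evec {κ : Type*} (W : Matrix κ κ ℂ) (i j : κ) : κ → ℂ :=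
  fun x => W x i * schurInv W x j

/-- The Nomura algebra of `W`: the matrices having every `W e_i ∘ W^(-) e_j` as eigenvector. -/
def nomura (W : Matrix ι ι ℂ) : Subalgebra ℂ (Matrix ι ι ℂ) where
  carrier := {M | ∀ i j, ∃ c : ℂ, M *ᵥ evec W i j = c • evec W i j}
  mul_mem' := by
    intro M N hM hN i j
    obtain ⟨a, ha⟩ := hM i j
    obtain ⟨b, hb⟩ := hN i j
    exact ⟨b * a, by rw [← Matrix.mulVec_mulVec, hb, Matrix.mulVec_smul, ha, smul_smul]⟩
  add_mem' := by
    intro M N hM hN i j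
    obtain ⟨a, ha⟩ := hM i j
    obtain ⟨b, hb⟩ := hN i j
    exact ⟨a + b, by rw [Matrix.add_mulVec, ha, hb, add_smul]⟩
  algebraMap_mem' := by
    intro r i j
    exact ⟨r, by rw [Algebra.algebraMap_eq_smul_one, Matrix.smul_mulVec, Matrix.one_mulVec]⟩

/-- The duality map `Θ_W`, defined on the Nomura algebra of `W`: the `(i, j)` entry of `Θ_W(M)` is
the eigenvalue of `M` on `W e_i ∘ W^(-) e_j`. It is unique when `W` has no zero entry, the vector
being then nonzero. -/
noncomputable def theta (W : Matrix ι ι ℂ) (M : Matrix ι ι ℂ) (hM : M ∈ nomura W) :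
    Matrix ι ι ℂ :=
  Matrix.of fun i j => Classical.choose (hM i j)

theorem theta_spec (W M : Matrix ι ι ℂ) (hM : M ∈ nomura W) (i j : ι) :
    M *ᵥ evec W i j = theta W M hM i j • evec W i j :=
  Classical.choose_spec (hM i j)

theorem theta_unique (W M : Matrix ι ι ℂ) (hW : IsSchurInvertible W) (hM : M ∈ nomura W)
    (i j : ι) (c : ℂ) (hc : M *ᵥ evec W i j = c • evec W i j) : theta W M hM i j = c := by
  have h := congrFun ((theta_spec W M hM i j).symm.trans hc) i
  have h0 : evec W i j i ≠ 0 := mul_ne_zero (hW i i) (inv_ne_zero (hW i j))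
  exact mul_right_cancel₀ h0 h

/-- Index set of the four groups of rows and columns: size `4 |ι|`. -/
abbrev Four (ι : Type*) : Type _ := (ι ⊕ ι) ⊕ (ι ⊕ ι)

/-- The `2 × 2` block matrix all of whose blocks are `M`. -/
def blockSame {κ : Type*} (M : Matrix κ κ ℂ) : Matrix (κ ⊕ κ) (κ ⊕ κ) ℂ :=
  Matrix.fromBlocks M M M M

/-- The `2 × 2` block matrix with `M` on the diagonal and `-M` off the diagonal. -/
def blockAlt {κ : Type*} (M : Matrix κ κ ℂ) : Matrix (κ ⊕ κ) (κ ⊕ κ) ℂ :=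
  Matrix.fromBlocks M (-M) (-M) M

/-- The matrix `V` built from `A`, `B` and `d`. -/
noncomputable def matV {κ : Type*} (A B : Matrix κ κ ℂ) (d : ℂ) :
    Matrix (Four κ) (Four κ) ℂ :=
  Matrix.fromBlocks
    (blockAlt (d • A)) (blockSame (schurInv B))
    (blockSame (schurInv B)ᵀ) (blockAlt (d • A))

/-- The matrix `V'` built from `A`, `B` and `d`. -/
noncomputable def matV' {κ : Type*} (A B : Matrix κ κ ℂ) (d : ℂ) :
    Matrix (Four κ) (Four κ) ℂ :=
  Matrix.fromBlocks
    (blockAlt (d • A)) (blockSame (-schurInv B))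
    (blockSame (-(schurInv B)ᵀ)) (blockAlt (d • A))

/-- `D = diag(I, -I)` with blocks of half the size. -/
def matD (κ : Type*) [DecidableEq κ] : Matrix (Four κ) (Four κ) ℂ :=
  Matrix.fromBlocks 1 0 0 (-1)

end JonesPair

/-!
Write `D_c` for the diagonal matrix of the column `B e_c`. Applied to the matrix units, the braid
relation says `A D_c A = D_c A D_c`, that is, `A D_c A⁻¹ = D_c⁻¹ A D_c`. Its trace shows that all
columns of `B` have sum `tr A`; its diagonal then determines the entries of `A⁻¹`, and `A` turns
out to be type II. Reading its entries with another index fixed instead of `c` exchanges the roles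
of `A` and `B`, which gives that `B` is type II and the identities between `A` and `B^(-)` needed
for the star-triangle relation.

In `V` and `V'` all blocks have the form `M ⊗ [1, -1; -1, 1]` or `M ⊗ [1, 1; 1, 1]`. The two
`2 × 2` matrices are twice complementary orthogonal projections, so the type II equation and, for
each third index, the star-triangle relation of `V'` reduce to those identities for the blocks.
Finally, in `W e_i ∘ W^(-) e_j` a scaling of the rows of `W` cancels and a scaling of its columns
changes the vector by a scalar, so that `V` and `DVD` have the same Nomura eigenvectors.
-/

namespace JonesPair

open Matrix

section Diagonal

variable {ι K : Type*} [Fintype ι] [DecidableEq ι] [Field K] {v : ι → K}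

theorem inv_diagonal_of_ne_zero (hv : ∀ i, v i ≠ 0) :
    (diagonal v)⁻¹ = diagonal v⁻¹ :=
  inv_eq_left_inv <| by
    rw [diagonal_mul_diagonal, ← diagonal_one]
    exact congrArg diagonal (funext fun i => inv_mul_cancel₀ (hv i))

theorem isUnit_det_diagonal_of_ne_zero (hv : ∀ i, v i ≠ 0) :
    IsUnit (diagonal v).det := by
  rw [det_diagonal]
  exact (Finset.prod_ne_zero_iff.2 fun i _ => hv i).isUnit

end Diagonal

section Pair

variable {ι : Type*} [Fintype ι] [DecidableEq ι] {A B : Matrix ι ι ℂ}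

theorem BraidRelation.mul_diagonal_col_mul (h : BraidRelation A B) (c : ι) :
    A * diagonal (B.col c) * A = diagonal (B.col c) * A * diagonal (B.col c) := by
  ext a b
  have key : (A * (B ⊙ (A * single b c (1 : ℂ)))) a c =
      (B ⊙ (A * (B ⊙ single b c (1 : ℂ)))) a c :=
    congrFun (congrFun (LinearMap.congr_fun h (single b c 1)) a) c
  simp only [Matrix.mul_apply, hadamard_apply, single_apply, and_true, mul_ite, mul_one, mul_zero,
    Finset.sum_ite_eq, Finset.mem_univ, if_true] at key
  rw [Matrix.mul_assoc, Matrix.mul_apply]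
  simpa only [mul_diagonal, diagonal_mul, col_apply, mul_assoc] using key

namespace IsInvertibleJonesPair

protected theorem transpose (h : IsInvertibleJonesPair A B) : IsInvertibleJonesPair A Bᵀ where
  braid := h.braid_transpose
  braid_transpose := by simpa only [transpose_transpose] using h.braid
  isUnit_left := h.isUnit_left
  schur_left := h.schur_left
  isUnit_right := (isUnit_transpose B).2 h.isUnit_right
  schur_right i j := h.schur_right j i

theorem conj_diagonal_col (h : IsInvertibleJonesPair A B) (c : ι) :
    A * diagonal (B.col c) * A⁻¹ = diagonal (B.col c)⁻¹ * A * diagonal (B.col c) := by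
  have hA : IsUnit A.det := (isUnit_iff_isUnit_det A).1 h.isUnit_left
  have hB : ∀ i, B.col c i ≠ 0 := fun i => h.schur_right i c
  set D := diagonal (B.col c)
  have hD : IsUnit D.det := isUnit_det_diagonal_of_ne_zero hB
  calc A * D * A⁻¹ = D⁻¹ * (D * A * D) * A⁻¹ := by
        rw [Matrix.mul_assoc D, nonsing_inv_mul_cancel_left _ _ hD]
    _ = D⁻¹ * (A * D * A) * A⁻¹ := by rw [h.braid.mul_diagonal_col_mul c]
    _ = diagonal (B.col c)⁻¹ * A * D := by
        rw [← Matrix.mul_assoc, mul_nonsing_inv_cancel_right _ _ hA, ← Matrix.mul_assoc,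
          inv_diagonal_of_ne_zero hB]

theorem conj_diagonal_col_inv (h : IsInvertibleJonesPair A B) (c : ι) :
    A * diagonal (B.col c)⁻¹ * A⁻¹ = diagonal (B.col c)⁻¹ * A⁻¹ * diagonal (B.col c) := by
  have hA : IsUnit A.det := (isUnit_iff_isUnit_det A).1 h.isUnit_left
  have hB : ∀ i, B.col c i ≠ 0 := fun i => h.schur_right i c
  have hB' : ∀ i, (B.col c)⁻¹ i ≠ 0 := fun i => inv_ne_zero (hB i)
  simpa only [Matrix.mul_inv_rev, nonsing_inv_nonsing_inv A hA, inv_diagonal_of_ne_zero hB,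
    inv_diagonal_of_ne_zero hB', inv_inv, Matrix.mul_assoc] using
    congrArg (·⁻¹) (h.conj_diagonal_col c)

theorem sum_col_eq_trace (h : IsInvertibleJonesPair A B) (c : ι) :
    ∑ x, B x c = A.trace := by
  have hB : ∀ i, B.col c i ≠ 0 := fun i => h.schur_right i c
  have hD : IsUnit (diagonal (B.col c)) :=
    (isUnit_iff_isUnit_det _).2 (isUnit_det_diagonal_of_ne_zero hB)
  calc ∑ x, B x c = (diagonal (B.col c)).trace := (trace_diagonal _).symm
    _ = ((diagonal (B.col c))⁻¹ * A * diagonal (B.col c)).trace := by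
        rw [← trace_conj h.isUnit_left, h.conj_diagonal_col, inv_diagonal_of_ne_zero hB]
    _ = A.trace := trace_conj' hD A

theorem mul_diagonal_col_inv_mul (h : IsInvertibleJonesPair A B) (c : ι) :
    A * diagonal (A⁻¹.col c) * B = diagonal (A.col c) * schurInv B * diagonal (B.row c) := by
  ext a x
  have key := congrFun (congrFun (h.conj_diagonal_col x) a) c
  rw [Matrix.mul_apply] at key ⊢
  simp only [mul_diagonal, diagonal_mul, col_apply, row_apply, Pi.inv_apply] at key ⊢
  calc ∑ y, A a y * A⁻¹ y c * B y x = ∑ y, A a y * B y x * A⁻¹ y c := by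
        simp only [mul_right_comm]
    _ = A a c * schurInv B a x * B c x := by rw [key, mul_comm (B a x)⁻¹]; rfl

theorem mul_diagonal_col_inv_mul_schurInv (h : IsInvertibleJonesPair A B) (c : ι) :
    A * diagonal (A⁻¹.col c) * schurInv B =
      diagonal (A⁻¹.col c) * schurInv B * diagonal (B.row c) := by
  ext a x
  have key := congrFun (congrFun (h.conj_diagonal_col_inv x) a) c
  rw [Matrix.mul_apply] at key ⊢
  simp only [mul_diagonal, diagonal_mul, col_apply, row_apply, Pi.inv_apply] at key ⊢
  calc ∑ y, A a y * A⁻¹ y c * schurInv B y x = ∑ y, A a y * (B y x)⁻¹ * A⁻¹ y c := by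
        simp only [mul_right_comm, schurInv, map_apply]
    _ = A⁻¹ a c * schurInv B a x * B c x := by rw [key, mul_comm (B a x)⁻¹]; rfl

theorem trace_mul_mul_inv_apply (h : IsInvertibleJonesPair A B) (a y : ι) :
    A.trace * (A a y * A⁻¹ y a) = A a a := by
  set v : ι → ℂ := fun y => A a y * A⁻¹ y a
  have hone : 1 ᵥ* B = A.trace • 1 := funext fun c => by
    simpa [vecMul, dotProduct] using h.sum_col_eq_trace c
  have hv : v ᵥ* B = A a a • 1 := funext fun c => by
    have key := congrFun (congrFun (h.conj_diagonal_col c) a) a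
    rw [Matrix.mul_apply] at key
    simp only [mul_diagonal, diagonal_mul, col_apply, Pi.inv_apply] at key
    rw [mul_right_comm, inv_mul_cancel₀ (h.schur_right a c), one_mul] at key
    simpa [vecMul, dotProduct, v, mul_right_comm] using key
  have hvec : A.trace • v = A a a • 1 := vecMul_injective_of_isUnit h.isUnit_right <| by
    simp only [smul_vecMul, hone, hv, smul_comm A.trace]
  simpa using congrFun hvec y

theorem card_smul_inv (h : IsInvertibleJonesPair A B) :
    (Fintype.card ι : ℂ) • A⁻¹ = (schurInv A)ᵀ := by
  have hA : IsUnit A.det := (isUnit_iff_isUnit_det A).1 h.isUnit_left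
  ext y a
  have htrace : A.trace = Fintype.card ι * A a a := by
    have hrow : ∑ y, A a y * A⁻¹ y a = 1 := by
      rw [← Matrix.mul_apply, mul_nonsing_inv _ hA, one_apply_eq]
    rw [← mul_one A.trace, ← hrow, Finset.mul_sum]
    simp [h.trace_mul_mul_inv_apply a]
  have key := h.trace_mul_mul_inv_apply a y
  rw [htrace] at key
  refine eq_inv_of_mul_eq_one_left (mul_left_cancel₀ (h.schur_left a a) ?_)
  rw [Matrix.smul_apply, smul_eq_mul]
  linear_combination key

theorem isTypeII_left (h : IsInvertibleJonesPair A B) : IsTypeII A where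
  schur := h.schur_left
  mul_eq := by
    have hA : IsUnit A.det := (isUnit_iff_isUnit_det A).1 h.isUnit_left
    rw [← h.card_smul_inv, Matrix.mul_smul, mul_nonsing_inv _ hA]

theorem isTypeII_right (h : IsInvertibleJonesPair A B) : IsTypeII B where
  schur := h.schur_right
  mul_eq := by
    have hA : IsUnit A.det := (isUnit_iff_isUnit_det A).1 h.isUnit_left
    ext a b
    simp only [Matrix.mul_apply, schurInv, transpose_apply, map_apply, Matrix.smul_apply, one_apply,
      smul_eq_mul, mul_ite, mul_one, mul_zero]
    split_ifs with hab
    · subst hab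
      simp [mul_inv_cancel₀ (h.schur_right a _)]
    refine (mul_eq_zero.1 ?_).resolve_left (h.schur_left b a)
    calc A b a * ∑ x, B a x * (B b x)⁻¹
        = ∑ x, (A * diagonal (A⁻¹.col a) * B) b x := by
          simp [h.mul_diagonal_col_inv_mul a, schurInv, Finset.mul_sum, mul_assoc, mul_comm (B a _)]
      _ = ∑ y, A b y * A⁻¹ y a * ∑ x, B y x := by
          simp only [Matrix.mul_apply (N := B), mul_diagonal, col_apply, Finset.mul_sum]
          exact Finset.sum_comm
      _ = (A * A⁻¹) b a * A.trace := by
          simp only [h.transpose.sum_col_eq_trace, ← transpose_apply B, Matrix.mul_apply,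
            Finset.sum_mul]
      _ = 0 := by rw [mul_nonsing_inv _ hA, one_apply_ne (Ne.symm hab), zero_mul]

theorem card_smul_diagonal_col_inv (h : IsInvertibleJonesPair A B) (c : ι) :
    (Fintype.card ι : ℂ) • diagonal (A⁻¹.col c) = diagonal (A.row c)⁻¹ := by
  rw [← diagonal_smul]
  exact congrArg diagonal (funext fun y => congrFun (congrFun h.card_smul_inv y) c)

theorem mul_diagonal_inv_row_mul_schurInv (h : IsInvertibleJonesPair A B) (c : ι) :
    A * diagonal (A.row c)⁻¹ * schurInv B =
      diagonal (A.row c)⁻¹ * schurInv B * diagonal (B.row c) := by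
  rw [← h.card_smul_diagonal_col_inv]
  simp only [Matrix.mul_smul, Matrix.smul_mul, h.mul_diagonal_col_inv_mul_schurInv c]

theorem schurInv_mul_diagonal_row_mul (h : IsInvertibleJonesPair A B) (c : ι) :
    schurInv B * diagonal (B.row c) * (schurInv B)ᵀ =
      diagonal (A.col c)⁻¹ * A * diagonal (A.row c)⁻¹ := by
  have hA : ∀ i, A.col c i ≠ 0 := fun i => h.schur_left i c
  set D := diagonal (A.col c)
  have hD : IsUnit D.det := isUnit_det_diagonal_of_ne_zero hA
  rw [← inv_diagonal_of_ne_zero hA]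
  calc schurInv B * diagonal (B.row c) * (schurInv B)ᵀ
      = D⁻¹ * (D * schurInv B * diagonal (B.row c)) * (schurInv B)ᵀ := by
        rw [Matrix.mul_assoc D, nonsing_inv_mul_cancel_left _ _ hD]
    _ = D⁻¹ * (A * diagonal (A⁻¹.col c)) * (B * (schurInv B)ᵀ) := by
        rw [← h.mul_diagonal_col_inv_mul c]
        simp only [Matrix.mul_assoc]
    _ = D⁻¹ * A * diagonal (A.row c)⁻¹ := by
        rw [h.isTypeII_right.mul_eq, ← h.card_smul_diagonal_col_inv]
        simp only [Matrix.mul_smul, Matrix.mul_one, Matrix.mul_assoc]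

end IsInvertibleJonesPair

end Pair

section Scaling

variable {κ : Type*} [DecidableEq κ] [Fintype κ] {s t : κ → ℂ}

theorem evec_diagonal_mul_mul_diagonal (hs : ∀ x, s x ≠ 0) (W : Matrix κ κ ℂ) (i j : κ) :
    evec (diagonal s * W * diagonal t) i j = (t i / t j) • evec W i j := by
  ext x
  simp only [evec, schurInv, map_apply, mul_diagonal, diagonal_mul, Pi.smul_apply, smul_eq_mul]
  field_simp [hs x]

theorem mulVec_evec_diagonal_mul_mul_diagonal_iff (hs : ∀ x, s x ≠ 0) (ht : ∀ x, t x ≠ 0)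
    (W M : Matrix κ κ ℂ) (i j : κ) (c : ℂ) :
    M *ᵥ evec (diagonal s * W * diagonal t) i j = c • evec (diagonal s * W * diagonal t) i j ↔
      M *ᵥ evec W i j = c • evec W i j := by
  rw [evec_diagonal_mul_mul_diagonal hs, mulVec_smul, smul_comm c]
  exact (smul_right_injective _ (div_ne_zero (ht i) (ht j))).eq_iff

theorem nomura_diagonal_mul_mul_diagonal (hs : ∀ x, s x ≠ 0) (ht : ∀ x, t x ≠ 0)
    (W : Matrix κ κ ℂ) : nomura (diagonal s * W * diagonal t) = nomura W :=
  SetLike.ext fun M => forall₂_congr fun i j => exists_congr fun c =>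
    mulVec_evec_diagonal_mul_mul_diagonal_iff hs ht W M i j c

theorem theta_diagonal_mul_mul_diagonal (hs : ∀ x, s x ≠ 0) (ht : ∀ x, t x ≠ 0)
    {W M : Matrix κ κ ℂ} (hW : IsSchurInvertible (diagonal s * W * diagonal t))
    (hM' : M ∈ nomura (diagonal s * W * diagonal t)) (hM : M ∈ nomura W) :
    theta (diagonal s * W * diagonal t) M hM' = theta W M hM := by
  ext i j
  exact theta_unique _ M hW hM' i j _ <|
    (mulVec_evec_diagonal_mul_mul_diagonal_iff hs ht W M i j _).2 (theta_spec W M hM i j)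

end Scaling

section SchurInv

variable {κ : Type*} (M : Matrix κ κ ℂ)

theorem schurInv_smul (c : ℂ) : schurInv (c • M) = c⁻¹ • schurInv M := by
  ext; simp [schurInv, mul_comm]

theorem schurInv_neg : schurInv (-M) = -schurInv M := by
  ext; simp [schurInv]

theorem schurInv_schurInv : schurInv (schurInv M) = M := by
  ext; simp [schurInv]

end SchurInv

section SpinModel

variable {κ τ : Type*} [Fintype κ] [DecidableEq κ] [Fintype τ] [DecidableEq τ] {W : Matrix κ κ ℂ}

protected theorem IsTypeII.transpose (h : IsTypeII W) : IsTypeII Wᵀ where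
  schur i j := h.schur j i
  mul_eq := by
    rcases isEmpty_or_nonempty κ with _ | _
    · exact Subsingleton.elim _ _
    have hcard : (Fintype.card κ : ℂ) ≠ 0 := Nat.cast_ne_zero.2 Fintype.card_ne_zero
    have hright : W * ((Fintype.card κ : ℂ)⁻¹ • (schurInv W)ᵀ) = 1 := by
      rw [Matrix.mul_smul, h.mul_eq, inv_smul_smul₀ hcard]
    have hleft := mul_eq_one_comm.1 hright
    rw [Matrix.smul_mul, inv_smul_eq_iff₀ hcard] at hleft
    have hleft' : Wᵀ * schurInv W = (Fintype.card κ : ℂ) • 1 := by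
      simpa using congrArg Matrix.transpose hleft
    exact hleft'

protected theorem IsTypeII.schurInv (h : IsTypeII W) : IsTypeII (schurInv W) where
  schur i j := inv_ne_zero (h.schur i j)
  mul_eq := by
    rw [schurInv_schurInv]
    simpa using congrArg Matrix.transpose h.mul_eq

protected theorem IsTypeII.smul (h : IsTypeII W) {c : ℂ} (hc : c ≠ 0) : IsTypeII (c • W) where
  schur i j := mul_ne_zero hc (h.schur i j)
  mul_eq := by
    rw [schurInv_smul, transpose_smul, Matrix.smul_mul, Matrix.mul_smul, smul_inv_smul₀ hc,
      h.mul_eq]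

/-- The star-triangle relation of `W` for a fixed third index `c`, as an identity between matrices:
this form lends itself to block multiplication. -/
def StarTriangleAt (W : Matrix κ κ ℂ) (δ : ℂ) (c : κ) : Prop :=
  W * diagonal (W.col c)⁻¹ * W = δ • (diagonal (W.col c)⁻¹ * W * diagonal (W.col c)⁻¹)

theorem StarTriangleAt.sum_eq {δ : ℂ} {c : κ} (h : StarTriangleAt W δ c) (a b : κ) :
    ∑ x, W a x * W x b / W x c = δ * (W a b / (W b c * W a c)) := by
  have key := congrFun (congrFun h a) b
  rw [Matrix.mul_apply, Matrix.smul_apply] at key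
  simp only [mul_diagonal, diagonal_mul, col_apply, Pi.inv_apply, smul_eq_mul] at key
  calc ∑ x, W a x * W x b / W x c = ∑ x, W a x * (W x c)⁻¹ * W x b :=
        Finset.sum_congr rfl fun x _ => by ring
    _ = δ * (W a b / (W b c * W a c)) := by rw [key]; ring

protected theorem StarTriangleAt.submatrix {δ : ℂ} {c : τ} (e : τ ≃ κ)
    (h : StarTriangleAt W δ (e c)) :
    StarTriangleAt (W.submatrix e e) δ c := by
  have hdiag : diagonal ((W.submatrix e e).col c)⁻¹ =
      (diagonal (W.col (e c))⁻¹).submatrix e e := by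
    rw [submatrix_diagonal_equiv]
    rfl
  rw [StarTriangleAt, hdiag]
  simp only [submatrix_mul_equiv]
  exact congrArg (·.submatrix e e) h

end SpinModel

section Blocks

variable {κ : Type*} (M N : Matrix κ κ ℂ)

theorem schurInv_fromBlocks (P Q R S : Matrix κ κ ℂ) :
    schurInv (fromBlocks P Q R S) =
      fromBlocks (schurInv P) (schurInv Q) (schurInv R) (schurInv S) :=
  fromBlocks_map P Q R S _

theorem schurInv_blockAlt : schurInv (blockAlt M) = blockAlt (schurInv M) := by
  simp only [blockAlt, schurInv_fromBlocks, schurInv_neg]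

theorem schurInv_blockSame : schurInv (blockSame M) = blockSame (schurInv M) :=
  schurInv_fromBlocks M M M M

theorem transpose_blockAlt : (blockAlt M)ᵀ = blockAlt Mᵀ := by
  simp only [blockAlt, fromBlocks_transpose, transpose_neg]

theorem transpose_blockSame : (blockSame M)ᵀ = blockSame Mᵀ :=
  fromBlocks_transpose M M M M

theorem blockAlt_smul (c : ℂ) : blockAlt (c • M) = c • blockAlt M := by
  simp only [blockAlt, fromBlocks_smul, smul_neg]

theorem blockSame_smul (c : ℂ) : blockSame (c • M) = c • blockSame M :=
  (fromBlocks_smul c M M M M).symm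

theorem blockAlt_one_add_blockSame_one [DecidableEq κ] :
    blockAlt (1 : Matrix κ κ ℂ) + blockSame 1 = (2 : ℂ) • 1 := by
  rw [← fromBlocks_one, fromBlocks_smul, smul_zero, two_smul]
  simp only [blockAlt, blockSame, fromBlocks_add, neg_add_cancel]

variable [Fintype κ]

theorem blockAlt_mul_blockAlt : blockAlt M * blockAlt N = (2 : ℂ) • blockAlt (M * N) := by
  simp [blockAlt, fromBlocks_multiply, fromBlocks_add, two_smul]

theorem blockSame_mul_blockSame : blockSame M * blockSame N = (2 : ℂ) • blockSame (M * N) := by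
  simp [blockSame, fromBlocks_multiply, fromBlocks_add, two_smul]

theorem blockAlt_mul_blockSame : blockAlt M * blockSame N = 0 := by
  simp [blockAlt, blockSame, fromBlocks_multiply]

theorem blockSame_mul_blockAlt : blockSame M * blockAlt N = 0 := by
  simp [blockAlt, blockSame, fromBlocks_multiply]

end Blocks

section FourBlock

/-- The common shape of the matrices `V` and `V'`, which are by definition
`fourBlock (d • A) B^(-)` and `fourBlock (d • A) (-B^(-))`. -/
def fourBlock {κ : Type*} (P Q : Matrix κ κ ℂ) : Matrix (Four κ) (Four κ) ℂ :=
  fromBlocks (blockAlt P) (blockSame Q) (blockSame Qᵀ) (blockAlt P)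

theorem sumElim_one_neg_one_ne_zero {κ : Type*} :
    ∀ x : Four κ, (Sum.elim 1 (-1) : Four κ → ℂ) x ≠ 0 := by
  rintro (_ | _) <;> simp

variable {κ : Type*} {P Q : Matrix κ κ ℂ}

theorem fourBlock_isSymm (hP : P.IsSymm) : (fourBlock P Q).IsSymm := by
  simp only [IsSymm, fourBlock, fromBlocks_transpose, transpose_blockAlt, transpose_blockSame,
    hP.eq, transpose_transpose]

theorem fourBlock_submatrix_swap :
    (fourBlock P Q).submatrix Sum.swap Sum.swap = fourBlock P Qᵀ := by
  simp only [fourBlock, fromBlocks_submatrix_sum_swap_sum_swap, transpose_transpose]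

theorem schurInv_fourBlock : schurInv (fourBlock P Q) = fourBlock (schurInv P) (schurInv Q) := by
  simp only [fourBlock, schurInv_fromBlocks, schurInv_blockAlt, schurInv_blockSame]
  rfl

theorem fourBlock_isSchurInvertible (hP : IsSchurInvertible P) (hQ : IsSchurInvertible Q) :
    IsSchurInvertible (fourBlock P Q) := by
  rintro ((i | i) | (i | i)) ((j | j) | (j | j)) <;>
    simp [fourBlock, blockAlt, blockSame, hP i j, hQ i j, hQ j i]

variable [DecidableEq κ]

theorem matD_eq_diagonal : matD κ = diagonal (Sum.elim 1 (-1)) := by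
  rw [← fromBlocks_diagonal]
  exact congrArg₂ (fromBlocks · 0 0 ·) diagonal_one.symm
    ((congrArg Neg.neg diagonal_one.symm).trans (diagonal_neg _))

variable [Fintype κ]

theorem matD_mul_fourBlock_mul_matD :
    matD κ * fourBlock P Q * matD κ = fourBlock P (-Q) := by
  simp [matD, fourBlock, fromBlocks_multiply, blockSame, fromBlocks_neg]

theorem fourBlock_neg_eq_diagonal_mul_mul_diagonal :
    fourBlock P (-Q) =
      diagonal (Sum.elim 1 (-1)) * fourBlock P Q * diagonal (Sum.elim 1 (-1)) := by
  rw [← matD_mul_fourBlock_mul_matD, matD_eq_diagonal]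

theorem nomura_fourBlock_neg : nomura (fourBlock P (-Q)) = nomura (fourBlock P Q) := by
  rw [fourBlock_neg_eq_diagonal_mul_mul_diagonal]
  exact nomura_diagonal_mul_mul_diagonal sumElim_one_neg_one_ne_zero
    sumElim_one_neg_one_ne_zero _

theorem theta_fourBlock_neg {M : Matrix (Four κ) (Four κ) ℂ}
    (hPQ : IsSchurInvertible (fourBlock P (-Q))) (hM' : M ∈ nomura (fourBlock P (-Q)))
    (hM : M ∈ nomura (fourBlock P Q)) :
    theta (fourBlock P (-Q)) M hM' = theta (fourBlock P Q) M hM := by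
  generalize hW : fourBlock P (-Q) = W at hPQ hM' ⊢
  rw [fourBlock_neg_eq_diagonal_mul_mul_diagonal] at hW
  subst hW
  exact theta_diagonal_mul_mul_diagonal sumElim_one_neg_one_ne_zero
    sumElim_one_neg_one_ne_zero hPQ hM' hM

protected theorem IsTypeII.fourBlock (hP : IsTypeII P) (hQ : IsTypeII Q) :
    IsTypeII (fourBlock P Q) where
  schur := fourBlock_isSchurInvertible hP.schur hQ.schur
  mul_eq := by
    have hQ' : Qᵀ * schurInv Q = (Fintype.card κ : ℂ) • (1 : Matrix κ κ ℂ) := hQ.transpose.mul_eq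
    have hcard : (Fintype.card (Four κ) : ℂ) = 2 * (2 * Fintype.card κ) := by
      simp only [Four, Fintype.card_sum, Nat.cast_add]
      ring
    rw [schurInv_fourBlock]
    simp only [fourBlock, fromBlocks_transpose, transpose_blockAlt, transpose_blockSame,
      transpose_transpose, fromBlocks_multiply, blockAlt_mul_blockAlt, blockSame_mul_blockSame,
      blockAlt_mul_blockSame, blockSame_mul_blockAlt, add_zero, hP.mul_eq, hQ.mul_eq, hQ',
      ← smul_add, blockAlt_smul, blockSame_smul, blockAlt_one_add_blockSame_one,
      add_comm (blockSame _), hcard]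
    rw [← fromBlocks_one (l := κ ⊕ κ) (m := κ ⊕ κ), fromBlocks_smul, smul_zero]
    simp only [smul_smul, mul_left_comm, mul_comm]

theorem fourBlock_braid {u v : κ → ℂ} {δ : ℂ} (hP : P.IsSymm)
    (h₁₁ : (2 : ℂ) • (Q * diagonal v * Qᵀ) = δ • (diagonal u * P * diagonal u))
    (h₁₂ : (2 : ℂ) • (P * diagonal u * Q) = δ • (diagonal u * Q * diagonal v))
    (h₂₂ : (2 : ℂ) • (P * diagonal v * P) = δ • (diagonal v * P * diagonal v)) :
    let D := diagonal (Sum.elim (Sum.elim u (-u)) (Sum.elim v v))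
    fourBlock P Q * D * fourBlock P Q = δ • (D * fourBlock P Q * D) := by
  intro D
  have h₂₁ : (2 : ℂ) • (Qᵀ * diagonal u * P) = δ • (diagonal v * Qᵀ * diagonal u) := by
    simpa [hP.eq, Matrix.mul_assoc] using congrArg Matrix.transpose h₁₂
  rw [two_smul] at h₁₁ h₁₂ h₂₁ h₂₂
  have hneg : diagonal (-u) = -diagonal u := (diagonal_neg u).symm
  simp only [D, ← fromBlocks_diagonal, hneg, fourBlock, blockAlt, blockSame, fromBlocks_multiply,
    fromBlocks_smul, fromBlocks_add, Matrix.mul_zero, Matrix.zero_mul, add_zero, zero_add,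
    Matrix.neg_mul, Matrix.mul_neg, neg_neg, add_neg_cancel, neg_add_cancel, ← neg_add, h₁₁,
    h₁₂, h₂₁, h₂₂, smul_neg, neg_zero]

theorem fourBlock_starTriangleAt_inl {δ : ℂ} (hP : P.IsSymm)
    (h₁₁ : ∀ c, (2 : ℂ) • (Q * diagonal (Q.row c)⁻¹ * Qᵀ) =
      δ • (diagonal (P.col c)⁻¹ * P * diagonal (P.col c)⁻¹))
    (h₁₂ : ∀ c, (2 : ℂ) • (P * diagonal (P.col c)⁻¹ * Q) =
      δ • (diagonal (P.col c)⁻¹ * Q * diagonal (Q.row c)⁻¹))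
    (h₂₂ : ∀ c, (2 : ℂ) • (P * diagonal (Q.row c)⁻¹ * P) =
      δ • (diagonal (Q.row c)⁻¹ * P * diagonal (Q.row c)⁻¹)) (c : κ ⊕ κ) :
    StarTriangleAt (fourBlock P Q) δ (.inl c) := by
  rcases c with c | c
  · have hcol : ((fourBlock P Q).col (.inl (.inl c)))⁻¹ =
        Sum.elim (Sum.elim (P.col c)⁻¹ (-(P.col c)⁻¹)) (Sum.elim (Q.row c)⁻¹ (Q.row c)⁻¹) := by
      ext ((x | x) | (x | x)) <;> simp [fourBlock, blockAlt, blockSame, inv_neg]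
    rw [StarTriangleAt, hcol]
    exact fourBlock_braid hP (h₁₁ c) (h₁₂ c) (h₂₂ c)
  · have hcol : ((fourBlock P Q).col (.inl (.inr c)))⁻¹ =
        Sum.elim (Sum.elim (-(P.col c)⁻¹) (- -(P.col c)⁻¹))
          (Sum.elim (Q.row c)⁻¹ (Q.row c)⁻¹) := by
      ext ((x | x) | (x | x)) <;> simp [fourBlock, blockAlt, blockSame, inv_neg]
    have hneg : diagonal (-(P.col c)⁻¹) = -diagonal (P.col c)⁻¹ := (diagonal_neg _).symm
    rw [StarTriangleAt, hcol]
    refine fourBlock_braid hP ?_ ?_ (h₂₂ c)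
    · simpa only [hneg, Matrix.neg_mul, Matrix.mul_neg, neg_neg] using h₁₁ c
    · simpa only [hneg, Matrix.neg_mul, Matrix.mul_neg, smul_neg, neg_inj] using h₁₂ c

end FourBlock

section JonesPairSpinModel

variable {ι : Type*} [Fintype ι] [DecidableEq ι] {A B : Matrix ι ι ℂ} {d : ℂ}

theorem IsInvertibleJonesPair.matV'_isTypeII (h : IsInvertibleJonesPair A B) (hd : d ≠ 0) :
    IsTypeII (matV' A B d) := by
  have hQ : IsTypeII (-schurInv B) := by
    simpa using h.isTypeII_right.schurInv.smul (neg_ne_zero.2 one_ne_zero)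
  exact (h.isTypeII_left.smul hd).fourBlock hQ

theorem IsInvertibleJonesPair.matV'_starTriangleAt_inl (h : IsInvertibleJonesPair A B)
    (hA : A.IsSymm) (hd : d ≠ 0) (c : ι ⊕ ι) : StarTriangleAt (matV' A B d) (-2 * d) (.inl c) := by
  have hP (c : ι) : diagonal ((d • A).col c)⁻¹ = d⁻¹ • diagonal (A.col c)⁻¹ := by
    rw [← diagonal_smul]
    exact congrArg diagonal (funext fun x => mul_inv d (A x c))
  have hQ (c : ι) : diagonal ((-schurInv B).row c)⁻¹ = -diagonal (B.row c) := by
    rw [diagonal_neg]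
    exact congrArg diagonal (funext fun x => by simp [schurInv, inv_neg])
  have hrow (c : ι) : A.row c = A.col c := funext fun x => hA.apply x c
  refine fourBlock_starTriangleAt_inl (hA.smul d) (fun c => ?_) (fun c => ?_) (fun c => ?_) c
  · have key := h.schurInv_mul_diagonal_row_mul c
    rw [hrow] at key
    simp only [hP, hQ, transpose_neg, Matrix.neg_mul, Matrix.mul_neg, neg_neg, Matrix.smul_mul,
      Matrix.mul_smul, smul_smul, key, smul_neg, ← neg_smul]
    congr 1
    field_simp
  · have key := h.mul_diagonal_inv_row_mul_schurInv c
    rw [hrow] at key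
    simp only [hP, hQ, Matrix.mul_neg, neg_neg, Matrix.smul_mul, Matrix.mul_smul, smul_smul, key,
      ← neg_smul]
    congr 1
    field_simp
  · have key : A * diagonal (B.row c) * A = diagonal (B.row c) * A * diagonal (B.row c) :=
      h.braid_transpose.mul_diagonal_col_mul c
    simp only [hQ, Matrix.neg_mul, Matrix.mul_neg, neg_neg, Matrix.smul_mul, Matrix.mul_smul,
      smul_smul, key, smul_neg, ← neg_smul]
    congr 1
    field_simp

theorem IsInvertibleJonesPair.matV'_starTriangleAt (h : IsInvertibleJonesPair A B)
    (hA : A.IsSymm) (hd : d ≠ 0) : ∀ c, StarTriangleAt (matV' A B d) (-2 * d) c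
  | .inl c => h.matV'_starTriangleAt_inl hA hd c
  | .inr c => by
    have hswap : (matV' A Bᵀ d).submatrix Sum.swap Sum.swap = matV' A B d :=
      fourBlock_submatrix_swap
    rw [← hswap]
    exact StarTriangleAt.submatrix (Equiv.sumComm _ _)
      (h.transpose.matV'_starTriangleAt_inl hA hd c)

theorem IsInvertibleJonesPair.matV'_isSpinModel (h : IsInvertibleJonesPair A B) (hA : A.IsSymm)
    (hd : d ^ 2 = (Fintype.card ι : ℂ)) : IsSpinModel (matV' A B d) (-2 * d) := by
  have hloop : (-2 * d) ^ 2 = (Fintype.card (Four ι) : ℂ) := by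
    simp only [Four, Fintype.card_sum, Nat.cast_add, ← hd]
    ring
  rcases isEmpty_or_nonempty ι with _ | _
  · exact ⟨hloop, ⟨isEmptyElim, Subsingleton.elim _ _⟩, isEmptyElim⟩
  have hd0 : d ≠ 0 := by
    rintro rfl
    simp [eq_comm] at hd
  exact ⟨hloop, h.matV'_isTypeII hd0, fun a b c => (h.matV'_starTriangleAt hA hd0 c).sum_eq a b⟩

end JonesPairSpinModel

end JonesPair

theorem mainTheorem4_general {ι : Type*} [Fintype ι] [DecidableEq ι] {d : ℂ}
    (hd : d ^ 2 = (Fintype.card ι : ℂ)) {A B : Matrix ι ι ℂ}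
    (hAB : JonesPair.IsInvertibleJonesPair A B) (hA : A.IsSymm) :
    JonesPair.matV' A B d = JonesPair.matD ι * JonesPair.matV A B d * JonesPair.matD ι ∧
      (JonesPair.matV' A B d).IsSymm ∧
      JonesPair.IsSpinModel (JonesPair.matV' A B d) (-2 * d) ∧
      ∃ h : JonesPair.nomura (JonesPair.matV' A B d) = JonesPair.nomura (JonesPair.matV A B d),
        ∀ (M : Matrix (JonesPair.Four ι) (JonesPair.Four ι) ℂ)
          (hM : M ∈ JonesPair.nomura (JonesPair.matV' A B d)),
          JonesPair.theta (JonesPair.matV' A B d) M hM =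
            JonesPair.theta (JonesPair.matV A B d) M (h ▸ hM) := by
  have hspin := hAB.matV'_isSpinModel hA hd
  exact ⟨JonesPair.matD_mul_fourBlock_mul_matD.symm, JonesPair.fourBlock_isSymm (hA.smul d), hspin,
    JonesPair.nomura_fourBlock_neg, fun _ hM =>
      JonesPair.theta_fourBlock_neg hspin.typeII.schur hM _⟩

theorem mainTheorem4 (n : ℕ) (d : ℂ) (hd : d ^ 2 = (n : ℂ))
    (A B : Matrix (Fin n) (Fin n) ℂ)
    (hAB : JonesPair.IsInvertibleJonesPair A B) (hA : A.IsSymm) :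
    JonesPair.matV' A B d =
        JonesPair.matD (Fin n) * JonesPair.matV A B d * JonesPair.matD (Fin n) ∧
      (JonesPair.matV' A B d).IsSymm ∧
      JonesPair.IsSpinModel (JonesPair.matV' A B d) (-2 * d) ∧
      ∃ h : JonesPair.nomura (JonesPair.matV' A B d) = JonesPair.nomura (JonesPair.matV A B d),
        ∀ (M : Matrix (JonesPair.Four (Fin n)) (JonesPair.Four (Fin n)) ℂ)
          (hM : M ∈ JonesPair.nomura (JonesPair.matV' A B d)),
          JonesPair.theta (JonesPair.matV' A B d) M hM =
            JonesPair.theta (JonesPair.matV A B d) M (h ▸ hM) := by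
  exact mainTheorem4_general (by rw [hd, Fintype.card_fin]) hAB hA
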